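/- Let $n\ge 1$ and let $I^n=[0,1]^n\subset\mathbb{R}^n$. A binary simplex is a nondegenerate $n$-simplex whose $n+1$ vertices lie in $\{0,1\}^n$; it is nonobtuse if none of its dihedral angles (angles between two of its facets) exceeds $\pi/2$. A path simplex is a binary simplex whose vertices can be ordered as $v_0,v_1,\dots,v_n$ such that the $n$ edges $v_{i}-v_{i-1}$, $1\le i\le n$, are mutually orthogonal. A nonobtuse binary triangulation of $I^n$ is a set of nonobtuse binary simplices whose union is $I^n$ and any two of which intersect in the (possibly empty) common face spanned by their common vertices. The standard triangulation $\mathcal{T}_\mathcal{S}^n$ consists of the simplices with vertices $0,\ e_{\sigma(1)},\ e_{\sigma(1)}+e_{\sigma(2)},\ \dots,\ e_{\sigma(1)}+\dots+e_{\sigma(n)}$, where $\sigma$ runs over all permutations of $\{1,\dots,n\}$ and $e_1,\dots,e_n$ is the standard basis. Then: 1. $\mathcal{T}_\mathcal{S}^n$ is a nonobtuse binary triangulation of $I^n$ that consists of exactly $n!$ simplices, all of which are path simplices. 2. Up to the symmetries of the cube, $\mathcal{T}_\mathcal{S}^n$ is the only nonobtuse binary triangulation of $I^n$ that contains a path simplex: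 if $\mathcal{T}$ is a nonobtuse binary triangulation of $I^n$ that contains a path simplex, then $\mathcal{T}=g(\mathcal{T}_\mathcal{S}^n)$ for an isometry $g$ of $\mathbb{R}^n$ with $g(I^n)=I^n$. Moreover, each path simplex belongs to exactly one nonobtuse binary triangulation of $I^n$. 3. If a nonobtuse binary simplex has two antipodal vertices $v$ and $(1,\dots,1)-v$ of the cube among its vertices (that is, if a long diagonal of $I^n$ is one of its edges), then it is a path simplex. -/

import Mathlib

namespace CubeTriangulation

noncomputable section

/-- The unit cube `I^n` in Euclidean space. -/
def unitCube (n : ℕ) : Set (EuclideanSpace ℝ (Fin n)) :=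
  {x | ∀ i, 0 ≤ x i ∧ x i ≤ 1}

/-- `v` is a vertex of the unit cube, that is, a vector with all entries in `{0, 1}`. -/
def IsCubeVertex {n : ℕ} (v : EuclideanSpace ℝ (Fin n)) : Prop :=
  ∀ i, v i = 0 ∨ v i = 1

/-- Binary `n`-simplices: nondegenerate `n`-simplices whose `n + 1` vertices are vertices of the
unit cube. A simplex is represented by its vertex set; as a body it is the convex hull of it. -/
structure IsBinarySimplex {n : ℕ} (S : Finset (EuclideanSpace ℝ (Fin n))) : Prop where
  card_eq : S.card = n + 1
  affineIndependent : AffineIndependent ℝ ((↑) : S → EuclideanSpace ℝ (Fin n))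
  isCubeVertex : ∀ v ∈ S, IsCubeVertex v

/-- For distinct vertices `p` and `q` of the simplex `S`: the component of `p - q` orthogonal to the
facet of `S` opposite `p`. It is the altitude vector of `S` at `p`, and does not depend on `q`. Thus
it is a normal vector of that facet pointing towards the side of `S`. -/
def innerNormal {n : ℕ} (S : Finset (EuclideanSpace ℝ (Fin n))) (p q : EuclideanSpace ℝ (Fin n)) :
    EuclideanSpace ℝ (Fin n) :=
  (vectorSpan ℝ ((S : Set (EuclideanSpace ℝ (Fin n))) \ {p}))ᗮ.starProjection (p - q)

/-- The dihedral angle of the simplex `S` between its facets opposite the distinct vertices `p` and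
`q`: it is `π` minus the angle between the inner normals of these facets. -/
def dihedralAngle {n : ℕ} (S : Finset (EuclideanSpace ℝ (Fin n)))
    (p q : EuclideanSpace ℝ (Fin n)) : ℝ :=
  Real.pi - InnerProductGeometry.angle (innerNormal S p q) (innerNormal S q p)

/-- A simplex is nonobtuse if none of its dihedral angles is obtuse. -/
def IsNonobtuse {n : ℕ} (S : Finset (EuclideanSpace ℝ (Fin n))) : Prop :=
  ∀ p ∈ S, ∀ q ∈ S, p ≠ q → dihedralAngle S p q ≤ Real.pi / 2

/-- Path simplices: binary simplices with `n` mutually orthogonal edges that form a path through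
all `n + 1` vertices `v 0, v 1, …, v n`. -/
def IsPathSimplex {n : ℕ} (S : Finset (EuclideanSpace ℝ (Fin n))) : Prop :=
  IsBinarySimplex S ∧
    ∃ v : Fin (n + 1) → EuclideanSpace ℝ (Fin n),
      Function.Injective v ∧ Set.range v = (S : Set (EuclideanSpace ℝ (Fin n))) ∧
        ∀ i j : Fin n, i ≠ j →
          inner ℝ (v i.succ - v i.castSucc) (v j.succ - v j.castSucc) = 0

/-- Binary triangulations of the unit cube: sets of binary `n`-simplices that cover the cube and
meet face to face, that is, any two of them intersect in the (possibly empty) face spanned by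
their common vertices. -/
structure IsBinaryTriangulation {n : ℕ} (T : Set (Finset (EuclideanSpace ℝ (Fin n)))) : Prop where
  isBinarySimplex : ∀ S ∈ T, IsBinarySimplex S
  iUnion_eq : ⋃ S ∈ T, convexHull ℝ (S : Set (EuclideanSpace ℝ (Fin n))) = unitCube n
  face_to_face : ∀ S ∈ T, ∀ S' ∈ T,
    convexHull ℝ (S : Set (EuclideanSpace ℝ (Fin n))) ∩ convexHull ℝ S' =
      convexHull ℝ ((S : Set (EuclideanSpace ℝ (Fin n))) ∩ S')

/-- Binary triangulations all of whose simplices are nonobtuse. -/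
def IsNonobtuseBinaryTriangulation {n : ℕ} (T : Set (Finset (EuclideanSpace ℝ (Fin n)))) : Prop :=
  IsBinaryTriangulation T ∧ ∀ S ∈ T, IsNonobtuse S

/-- The vertex `e_{σ 0} + ⋯ + e_{σ (k - 1)}` of the unit cube. -/
def pathVertex {n : ℕ} (σ : Equiv.Perm (Fin n)) (k : Fin (n + 1)) : EuclideanSpace ℝ (Fin n) :=
  WithLp.toLp 2 (fun j => if (σ.symm j : ℕ) < k then 1 else 0)

open Classical in
/-- The simplex with vertices `0, e_{σ 0}, e_{σ 0} + e_{σ 1}, …, e_{σ 0} + ⋯ + e_{σ (n - 1)}`. -/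
def standardSimplex {n : ℕ} (σ : Equiv.Perm (Fin n)) : Finset (EuclideanSpace ℝ (Fin n)) :=
  Finset.univ.image (pathVertex σ)

/-- The standard triangulation of the unit cube, one simplex for each permutation of the
coordinates. -/
def standardTriangulation (n : ℕ) : Set (Finset (EuclideanSpace ℝ (Fin n))) :=
  Set.range standardSimplex

/-- Symmetries of the unit cube: isometries of space that map the cube onto itself. -/
def IsCubeSymmetry {n : ℕ} (g : EuclideanSpace ℝ (Fin n) ≃ᵢ EuclideanSpace ℝ (Fin n)) : Prop :=
  g '' unitCube n = unitCube n

/-- The image of a set of simplices under an isometry. -/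
def mapTriangulation {n : ℕ} (g : EuclideanSpace ℝ (Fin n) ≃ᵢ EuclideanSpace ℝ (Fin n))
    (T : Set (Finset (EuclideanSpace ℝ (Fin n)))) : Set (Finset (EuclideanSpace ℝ (Fin n))) :=
  (fun S => S.map g.toEquiv.toEmbedding) '' T

end

end CubeTriangulation

/-! A simplex is nonobtuse exactly when the gradients of its barycentric coordinates have pairwise
nonpositive inner products (`IsDualFamily.isNonobtuse_iff`). This yields a discrete minimum
principle, `IsDualFamily.inner_nonneg`.

Let a nonobtuse binary simplex contain antipodal vertices `o`, `w`, and let `p`, `q` be vertices of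
it. The diagonal is seen from `p` under a right angle, and the minimum principle for the face on
`o`, `p`, `q` gives `⟨o - p, q - p⟩ * ⟨w - p, q - p⟩ ≤ 0`. Both factors are sums of nonnegative
terms, since `p` is a cube vertex, so one of them vanishes termwise. Hence the vertices form a chain
under inclusion of the coordinate sets in which they differ from `o`, and a chain is an orthogonal
path.

Conversely, Pythagoras forces a path simplex to flip one coordinate per step, each exactly once
(`exists_perm_of_orthogonal_path`). So it contains a long diagonal, and reflecting its starting
point to the origin makes it a standard simplex. Standard simplices are the regions of the cube
where the coordinates have a prescribed order.

Uniqueness is a local argument at the midpoint of the diagonal (`IsBinaryTriangulation.eq_of_edge`).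
The simplices of a nonobtuse triangulation that contain the diagonal all lie in one reflected
standard triangulation, every simplex of which contains the diagonal. Face-to-face intersection near
the midpoint then forces all of these simplices to occur, and they already fill the cube. -/

namespace CubeTriangulation

/-- `g` is the family of gradients of the barycentric coordinates with respect to the points `p`. -/
def IsDualFamily {E ι : Type*} [NormedAddCommGroup E] [InnerProductSpace ℝ E] [DecidableEq ι]
    (p g : ι → E) : Prop :=
  ∀ i j k, inner ℝ (g i) (p j - p k) = (if j = i then (1 : ℝ) else 0) - if k = i then 1 else 0

/-! ### Gradients of barycentric coordinates and the discrete minimum principle -/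

section DualFamily

variable {E ι : Type*} [NormedAddCommGroup E] [InnerProductSpace ℝ E]

theorem inner_eq_zero_of_mem_vectorSpan {s : Set E} {x y : E}
    (h : ∀ a ∈ s, ∀ b ∈ s, inner ℝ x (a - b) = 0) (hy : y ∈ vectorSpan ℝ s) :
    inner ℝ x y = 0 := by
  have hle : vectorSpan ℝ s ≤ (ℝ ∙ x)ᗮ := by
    rw [vectorSpan_def, Submodule.span_le]
    rintro _ ⟨a, ha, b, hb, rfl⟩
    exact Submodule.mem_orthogonal_singleton_iff_inner_right.2 (h a ha b hb)
  exact Submodule.mem_orthogonal_singleton_iff_inner_right.1 (hle hy)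

theorem eq_of_inner_sub_eq {p : ι → E} (hp : vectorSpan ℝ (Set.range p) = ⊤) {x y : E}
    (h : ∀ j k, inner ℝ x (p j - p k) = inner ℝ y (p j - p k)) : x = y := by
  rw [← sub_eq_zero, ← inner_self_eq_zero (𝕜 := ℝ)]
  refine inner_eq_zero_of_mem_vectorSpan (s := Set.range p) ?_ (hp ▸ Submodule.mem_top)
  rintro _ ⟨j, rfl⟩ _ ⟨k, rfl⟩
  rw [inner_sub_left, h, sub_self]

variable [DecidableEq ι]

theorem IsDualFamily.affineIndependent {p g : ι → E} (h : IsDualFamily p g) :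
    AffineIndependent ℝ p := by
  rw [affineIndependent_iff]
  intro s w hw hsum i hi
  have h1 : inner ℝ (g i) (∑ j ∈ s, w j • (p j - p i)) = w i - ∑ j ∈ s, w j := by
    rw [inner_sum]
    simp only [inner_smul_right, h i, mul_sub, if_true, mul_one, Finset.sum_sub_distrib]
    simp [hi]
  have h2 : ∑ j ∈ s, w j • (p j - p i) = 0 := by
    simp only [smul_sub, Finset.sum_sub_distrib, hsum, ← Finset.sum_smul, hw, zero_smul, sub_zero]
  rw [h2, inner_zero_right, hw] at h1
  linarith

theorem IsDualFamily.ne_zero {p g : ι → E} (h : IsDualFamily p g) {i j : ι} (hij : i ≠ j) :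
    g i ≠ 0 := by
  intro h0
  have := h i i j
  simp [h0, hij.symm] at this

/-- The base point `q` is arbitrary because the gradients sum to zero. -/
theorem IsDualFamily.eq_sum [Fintype ι] {p g : ι → E} (h : IsDualFamily p g)
    (hp : vectorSpan ℝ (Set.range p) = ⊤) (x q : E) :
    x = ∑ i, inner ℝ x (p i - q) • g i := by
  refine eq_of_inner_sub_eq hp fun j k => ?_
  rw [sum_inner]
  simp only [real_inner_smul_left, h _ j k, mul_sub, Finset.sum_sub_distrib, mul_ite, mul_one,
    mul_zero, Finset.sum_ite_eq, Finset.mem_univ, if_true]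
  rw [← inner_sub_right, sub_sub_sub_cancel_right]

/-- The `i`-th barycentric coordinate vanishes on the hull of the vertices other than `p i`, but
takes the value `w i` at the given point. -/
theorem IsDualFamily.mem_of_mem_convexHull [Fintype ι] {p g : ι → E} (h : IsDualFamily p g)
    {s : Set ι} {w : ι → ℝ} (hw : ∑ i, w i = 1)
    (hx : ∑ i, w i • p i ∈ convexHull ℝ (p '' s)) {i : ι} (hi : w i ≠ 0) : i ∈ s := by
  by_contra his
  obtain ⟨_, k, hk, rfl⟩ := convexHull_nonempty_iff.1 ⟨_, hx⟩
  have hki : k ≠ i := fun e => his (e ▸ hk)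
  have hsub : convexHull ℝ (p '' s) ⊆ {x | inner ℝ (g i) x = inner ℝ (g i) (p k)} := by
    refine convexHull_min ?_ ?_
    · rintro _ ⟨j, hj, rfl⟩
      have hji : j ≠ i := fun e => his (e ▸ hj)
      have := h i j k
      rw [if_neg hji, if_neg hki, inner_sub_right] at this
      simp only [Set.mem_ofPred_eq]
      linarith
    · exact convex_hyperplane (innerₗ E (g i)).isLinear _
  have h1 : inner ℝ (g i) (∑ j, w j • (p j - p k)) = w i := by
    rw [inner_sum]
    simp [inner_smul_right, h i, hki]
  have h2 : ∑ j, w j • (p j - p k) = ∑ j, w j • p j - p k := by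
    simp [smul_sub, Finset.sum_sub_distrib, ← Finset.sum_smul, hw]
  rw [h2, inner_sub_right, hsub hx, sub_self] at h1
  exact hi h1.symm

/-- Discrete minimum principle for nonobtuse simplices: a linear functional whose gradient is
parallel to a face attains its minimum on that face. -/
theorem IsDualFamily.inner_nonneg [Fintype ι] {p g : ι → E} (h : IsDualFamily p g)
    (hp : vectorSpan ℝ (Set.range p) = ⊤) (hg : ∀ i j, i ≠ j → inner ℝ (g i) (g j) ≤ 0)
    {s : Set ι} {x : E} (hx : x ∈ vectorSpan ℝ (p '' s)) {k : ι}
    (hs : ∀ i ∈ s, 0 ≤ inner ℝ x (p i - p k)) (i : ι) : 0 ≤ inner ℝ x (p i - p k) := by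
  have horth : ∀ i ∉ s, inner ℝ (g i) x = 0 := by
    intro i hi
    refine inner_eq_zero_of_mem_vectorSpan ?_ hx
    rintro _ ⟨j, hj, rfl⟩ _ ⟨l, hl, rfl⟩
    rw [h, if_neg (fun e : j = i => hi (e ▸ hj)), if_neg (fun e : l = i => hi (e ▸ hl)), sub_self]
  set f : ι → ℝ := fun i => inner ℝ x (p i - p k) with hf
  -- Split `x = ∑ f i • g i` into its negative part `y` and positive part `z`. Then `⟨y, x⟩ = 0`,
  -- while nonobtuseness gives `⟨y, z⟩ ≥ 0`. So `‖y‖² = -⟨y, z⟩ ≤ 0`, and no `f i` is negative.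
  set y : E := ∑ i, min (f i) 0 • g i with hy
  set z : E := ∑ i, max (f i) 0 • g i with hz
  have hxyz : x = y + z := by
    rw [h.eq_sum hp x (p k), hy, hz, ← Finset.sum_add_distrib]
    refine Finset.sum_congr rfl fun i _ => ?_
    rw [← add_smul, min_add_max, add_zero]
  have hyx : inner ℝ y x = 0 := by
    rw [hy, sum_inner]
    refine Finset.sum_eq_zero fun i _ => ?_
    rw [real_inner_smul_left]
    by_cases hi : i ∈ s
    · rw [min_eq_right (hs i hi), zero_mul]
    · rw [horth i hi, mul_zero]
  have hyz : 0 ≤ inner ℝ y z := by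
    rw [hy, hz, sum_inner]
    refine Finset.sum_nonneg fun i _ => ?_
    rw [inner_sum]
    refine Finset.sum_nonneg fun j _ => ?_
    rw [real_inner_smul_left, real_inner_smul_right, ← mul_assoc]
    by_cases hij : i = j
    · subst hij
      rw [min_mul_max, mul_zero, zero_mul]
    · exact mul_nonneg_of_nonpos_of_nonpos
        (mul_nonpos_of_nonpos_of_nonneg (min_le_right _ _) (le_max_right _ _)) (hg i j hij)
  have hy0 : y = 0 := by
    rw [hxyz, inner_add_right] at hyx
    rw [← inner_self_eq_zero (𝕜 := ℝ)]
    exact le_antisymm (by linarith) real_inner_self_nonneg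
  have h1 : inner ℝ y (p i - p k) = min (f i) 0 := by
    rw [hy, sum_inner]
    simp only [real_inner_smul_left, h _ i k, mul_sub, Finset.sum_sub_distrib, mul_ite, mul_one,
      mul_zero, Finset.sum_ite_eq, Finset.mem_univ, if_true]
    simp [hf]
  rw [hy0, inner_zero_left] at h1
  exact h1 ▸ min_le_left (f i) 0

end DualFamily

/-! ### Dihedral angles in terms of gradients -/

section Nonobtuse

variable {n : ℕ}

theorem vectorSpan_eq_top_of_card {ι : Type*} [Fintype ι] {p : ι → EuclideanSpace ℝ (Fin n)}
    (hp : AffineIndependent ℝ p) (hc : Fintype.card ι = n + 1) :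
    vectorSpan ℝ (Set.range p) = ⊤ := by
  rw [← finrank_euclideanSpace_fin (𝕜 := ℝ) (n := n)] at hc
  exact hp.vectorSpan_eq_top_of_card_eq_finrank_add_one hc

theorem exists_isDualFamily {ι : Type*} [Fintype ι] [DecidableEq ι]
    {p : ι → EuclideanSpace ℝ (Fin n)}
    (hp : AffineIndependent ℝ p) (hc : Fintype.card ι = n + 1) : ∃ g, IsDualFamily p g := by
  let b : AffineBasis ι ℝ (EuclideanSpace ℝ (Fin n)) :=
    ⟨p, hp, by rw [hp.affineSpan_eq_top_iff_card_eq_finrank_add_one]; simpa using hc⟩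
  refine ⟨fun i => (InnerProductSpace.toDual ℝ _).symm
    (LinearMap.toContinuousLinearMap (b.coord i).linear), fun i j k => ?_⟩
  have hj : b.coord i (p j) = if i = j then 1 else 0 := b.coord_apply i j
  have hk : b.coord i (p k) = if i = k then 1 else 0 := b.coord_apply i k
  rw [InnerProductSpace.toDual_symm_apply, LinearMap.coe_toContinuousLinearMap', ← vsub_eq_sub,
    AffineMap.linearMap_vsub, hj, hk, vsub_eq_sub]
  simp only [eq_comm]

/-- The altitude vector and `g i` are both normal to the facet opposite `p i`, hence parallel; the
factor follows from `⟨N, g i⟩ = ⟨p i - p j, g i⟩ = 1`. -/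
theorem IsDualFamily.innerNormal_eq {ι : Type*} [DecidableEq ι]
    {p g : ι → EuclideanSpace ℝ (Fin n)} (h : IsDualFamily p g) (hinj : Function.Injective p)
    (hp : vectorSpan ℝ (Set.range p) = ⊤) {S : Finset (EuclideanSpace ℝ (Fin n))}
    (hS : Set.range p = S) {i j : ι} (hij : i ≠ j) :
    innerNormal S (p i) (p j) = (‖g i‖ ^ 2)⁻¹ • g i := by
  set W := vectorSpan ℝ ((S : Set (EuclideanSpace ℝ (Fin n))) \ {p i}) with hW
  set N := innerNormal S (p i) (p j) with hN
  have hg : g i ∈ Wᗮ := by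
    rw [Submodule.mem_orthogonal']
    refine fun u hu => inner_eq_zero_of_mem_vectorSpan ?_ hu
    rw [← hS]
    rintro _ ⟨⟨a, rfl⟩, ha⟩ _ ⟨⟨b, rfl⟩, hb⟩
    rw [h, if_neg (fun e : a = i => ha (e ▸ rfl)), if_neg (fun e : b = i => hb (e ▸ rfl)), sub_self]
  have hNW : N ∈ Wᗮ := Submodule.starProjection_apply_mem _ _
  have hNg : inner ℝ N (g i) = 1 := by
    have h1 : inner ℝ (p i - p j - N) (g i) = 0 := Submodule.starProjection_inner_eq_zero _ _ hg
    have h2 := h i i j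
    rw [if_pos rfl, if_neg hij.symm, real_inner_comm] at h2
    rw [inner_sub_left] at h1
    linarith
  have horth : ∀ a b, a ≠ i → b ≠ i → inner ℝ N (p a - p b) = 0 := by
    intro a b ha hb
    refine (Submodule.mem_orthogonal' _ _).1 hNW _ (vsub_mem_vectorSpan ℝ ?_ ?_)
    · exact ⟨hS ▸ ⟨a, rfl⟩, fun e => ha (hinj e)⟩
    · exact ⟨hS ▸ ⟨b, rfl⟩, fun e => hb (hinj e)⟩
  have hN' : N = (inner ℝ N (p i - p j)) • g i := by
    refine eq_of_inner_sub_eq hp fun a b => ?_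
    have key : ∀ a, inner ℝ N (p a - p j) = inner ℝ N (p i - p j) * if a = i then 1 else 0 := by
      intro a
      split_ifs with ha
      · rw [ha, mul_one]
      · rw [horth a j ha hij.symm, mul_zero]
    rw [real_inner_smul_left, h, mul_sub, ← key, ← key, ← inner_sub_right, sub_sub_sub_cancel_right]
  have hne : ‖g i‖ ^ 2 ≠ 0 := pow_ne_zero 2 (norm_ne_zero_iff.2 (h.ne_zero hij))
  rw [hN', real_inner_smul_left, real_inner_self_eq_norm_sq] at hNg
  rw [hN', eq_inv_of_mul_eq_one_left hNg]

theorem IsDualFamily.isNonobtuse_iff {ι : Type*} [DecidableEq ι]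
    {p g : ι → EuclideanSpace ℝ (Fin n)} (h : IsDualFamily p g) (hinj : Function.Injective p)
    (hp : vectorSpan ℝ (Set.range p) = ⊤) {S : Finset (EuclideanSpace ℝ (Fin n))}
    (hS : Set.range p = S) :
    IsNonobtuse S ↔ ∀ i j, i ≠ j → inner ℝ (g i) (g j) ≤ 0 := by
  have key : ∀ i j, i ≠ j →
      (dihedralAngle S (p i) (p j) ≤ Real.pi / 2 ↔ inner ℝ (g i) (g j) ≤ 0) := by
    intro i j hij
    have hi : 0 < (‖g i‖ ^ 2)⁻¹ := inv_pos.2 (pow_pos (norm_pos_iff.2 (h.ne_zero hij)) 2)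
    have hj : 0 < (‖g j‖ ^ 2)⁻¹ := inv_pos.2 (pow_pos (norm_pos_iff.2 (h.ne_zero hij.symm)) 2)
    rw [dihedralAngle, h.innerNormal_eq hinj hp hS hij, h.innerNormal_eq hinj hp hS hij.symm,
      InnerProductGeometry.angle_smul_left_of_pos _ _ hi,
      InnerProductGeometry.angle_smul_right_of_pos _ _ hj]
    rw [← not_iff_not, not_le, not_le, ← div_pos_iff_of_pos_right (mul_pos (norm_pos_iff.2 (h.ne_zero hij))
        (norm_pos_iff.2 (h.ne_zero hij.symm))), ← Real.arccos_lt_pi_div_two,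
      ← InnerProductGeometry.angle]
    constructor <;> intro _ <;> linarith
  constructor
  · intro hno i j hij
    exact (key i j hij).1 (hno _ (by rw [← Finset.mem_coe, ← hS]; exact ⟨i, rfl⟩) _
      (by rw [← Finset.mem_coe, ← hS]; exact ⟨j, rfl⟩) (hinj.ne hij))
  · intro hg x hx y hy hxy
    rw [← Finset.mem_coe, ← hS] at hx hy
    obtain ⟨i, rfl⟩ := hx
    obtain ⟨j, rfl⟩ := hy
    have hij : i ≠ j := fun e => hxy (e ▸ rfl)
    exact (key i j hij).2 (hg i j hij)

end Nonobtuse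

/-! ### The standard triangulation -/

section StandardTriangulation

variable {n : ℕ}

theorem inner_eq_sum_mul (x y : EuclideanSpace ℝ (Fin n)) : inner ℝ x y = ∑ i, x i * y i := by
  simp [PiLp.inner_apply, mul_comm]

theorem convex_unitCube : Convex ℝ (unitCube n) := by
  intro x hx y hy a b ha hb hab i
  simp only [PiLp.add_apply, PiLp.smul_apply, smul_eq_mul]
  have h1 := mul_le_mul_of_nonneg_left (hx i).2 ha
  have h2 := mul_le_mul_of_nonneg_left (hy i).2 hb
  exact ⟨add_nonneg (mul_nonneg ha (hx i).1) (mul_nonneg hb (hy i).1), by linarith⟩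

theorem IsCubeVertex.mem_unitCube {v : EuclideanSpace ℝ (Fin n)} (hv : IsCubeVertex v) :
    v ∈ unitCube n := by
  intro i
  rcases hv i with h | h <;> simp [h]

theorem isBinarySimplex_of_range {ι : Type*} [Fintype ι] (hc : Fintype.card ι = n + 1)
    {p : ι → EuclideanSpace ℝ (Fin n)} (hp : AffineIndependent ℝ p) (hv : ∀ k, IsCubeVertex (p k))
    {S : Finset (EuclideanSpace ℝ (Fin n))} (hS : Set.range p = S) : IsBinarySimplex S where
  card_eq := by
    rw [← Set.ncard_coe_finset, ← hS, ← Set.image_univ, Set.ncard_image_of_injective _ hp.injective,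
      Set.ncard_univ, Nat.card_eq_fintype_card, hc]
  affineIndependent := by
    have h := hp.range
    rw [hS] at h
    exact h
  isCubeVertex := by
    intro v hvS
    rw [← Finset.mem_coe, ← hS] at hvS
    obtain ⟨k, rfl⟩ := hvS
    exact hv k

theorem pathVertex_apply (σ : Equiv.Perm (Fin n)) (k : Fin (n + 1)) (j : Fin n) :
    pathVertex σ k j = if (σ.symm j : ℕ) < k then (1 : ℝ) else 0 := rfl

theorem isCubeVertex_pathVertex (σ : Equiv.Perm (Fin n)) (k : Fin (n + 1)) :
    IsCubeVertex (pathVertex σ k) := by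
  intro j
  rw [pathVertex_apply]
  split_ifs <;> simp

theorem range_pathVertex (σ : Equiv.Perm (Fin n)) :
    Set.range (pathVertex σ) = (standardSimplex σ : Set (EuclideanSpace ℝ (Fin n))) := by
  classical
  simp [standardSimplex]

/-- The gradients of the barycentric coordinates of the simplex `standardSimplex σ`. -/
noncomputable def pathGradient (σ : Equiv.Perm (Fin n)) (k : Fin (n + 1)) :
    EuclideanSpace ℝ (Fin n) :=
  WithLp.toLp 2 fun j =>
    (if (σ.symm j : ℕ) + 1 = k then (1 : ℝ) else 0) - if (σ.symm j : ℕ) = k then 1 else 0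

theorem pathGradient_apply (σ : Equiv.Perm (Fin n)) (k : Fin (n + 1)) (j : Fin n) :
    pathGradient σ k j =
      (if (σ.symm j : ℕ) + 1 = k then (1 : ℝ) else 0) - if (σ.symm j : ℕ) = k then 1 else 0 := rfl

/-- The barycentric coordinate of index `k` is `x (σ (k - 1)) - x (σ k)`, with `1` and `0` as outer
values. The correction at `k = 0` is the constant `1` lost in passing to the linear part; it cancels
in differences. -/
theorem inner_pathGradient_pathVertex (σ : Equiv.Perm (Fin n)) (k m : Fin (n + 1)) :
    inner ℝ (pathGradient σ k) (pathVertex σ m) =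
      (if m = k then (1 : ℝ) else 0) - if (k : ℕ) = 0 then 1 else 0 := by
  have key : ∀ N k m : ℕ, ∑ i ∈ Finset.range N,
      ((if i + 1 = k then (1 : ℝ) else 0) - if i = k then 1 else 0) * (if i < m then 1 else 0) =
      (if 1 ≤ k ∧ k ≤ N ∧ k ≤ m then 1 else 0) - if k < N ∧ k < m then 1 else 0 := by
    intro N k m
    induction N with
    | zero =>
      rw [Finset.sum_range_zero]
      split_ifs <;> first | omega | norm_num
    | succ N ih =>
      rw [Finset.sum_range_succ, ih]
      split_ifs <;> first | omega | norm_num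
  rw [inner_eq_sum_mul]
  simp only [pathGradient_apply, pathVertex_apply]
  rw [Equiv.sum_comp σ.symm (fun i : Fin n => ((if (i : ℕ) + 1 = k then (1 : ℝ) else 0) -
    if (i : ℕ) = k then 1 else 0) * (if (i : ℕ) < m then 1 else 0)),
    Fin.sum_univ_eq_sum_range (fun i : ℕ => ((if i + 1 = (k : ℕ) then (1 : ℝ) else 0) -
    if i = (k : ℕ) then 1 else 0) * (if i < (m : ℕ) then 1 else 0)), key]
  have hk := k.2
  have hm := m.2
  simp only [Fin.ext_iff]
  split_ifs <;> first | omega | norm_num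

theorem isDualFamily_pathGradient (σ : Equiv.Perm (Fin n)) :
    IsDualFamily (pathVertex σ) (pathGradient σ) := by
  intro i j k
  rw [inner_sub_right, inner_pathGradient_pathVertex, inner_pathGradient_pathVertex]
  ring

/-- Supports of distinct gradients meet only for consecutive indices, where the shared coordinate
enters with opposite signs. -/
theorem inner_pathGradient_nonpos (σ : Equiv.Perm (Fin n)) {k l : Fin (n + 1)} (hkl : k ≠ l) :
    inner ℝ (pathGradient σ k) (pathGradient σ l) ≤ 0 := by
  rw [inner_eq_sum_mul]
  refine Finset.sum_nonpos fun j _ => ?_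
  rw [pathGradient_apply, pathGradient_apply]
  have hkl' : (k : ℕ) ≠ l := fun e => hkl (Fin.ext e)
  split_ifs <;> first | omega | norm_num

theorem affineIndependent_pathVertex (σ : Equiv.Perm (Fin n)) :
    AffineIndependent ℝ (pathVertex σ) := (isDualFamily_pathGradient σ).affineIndependent

theorem vectorSpan_range_pathVertex (σ : Equiv.Perm (Fin n)) :
    vectorSpan ℝ (Set.range (pathVertex σ)) = ⊤ :=
  vectorSpan_eq_top_of_card (affineIndependent_pathVertex σ) (Fintype.card_fin _)

theorem isBinarySimplex_standardSimplex (σ : Equiv.Perm (Fin n)) :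
    IsBinarySimplex (standardSimplex σ) :=
  isBinarySimplex_of_range (Fintype.card_fin _) (affineIndependent_pathVertex σ)
    (isCubeVertex_pathVertex σ) (range_pathVertex σ)

theorem isNonobtuse_standardSimplex (σ : Equiv.Perm (Fin n)) : IsNonobtuse (standardSimplex σ) :=
  ((isDualFamily_pathGradient σ).isNonobtuse_iff (affineIndependent_pathVertex σ).injective
    (vectorSpan_range_pathVertex σ) (range_pathVertex σ)).2
    fun _ _ => inner_pathGradient_nonpos σ

theorem isPathSimplex_standardSimplex (σ : Equiv.Perm (Fin n)) :
    IsPathSimplex (standardSimplex σ) := by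
  refine ⟨isBinarySimplex_standardSimplex σ, pathVertex σ,
    (affineIndependent_pathVertex σ).injective, range_pathVertex σ, fun i j hij => ?_⟩
  rw [inner_eq_sum_mul]
  refine Finset.sum_eq_zero fun l _ => ?_
  have hij' : (i : ℕ) ≠ j := fun e => hij (Fin.ext e)
  simp only [PiLp.sub_apply, pathVertex_apply, Fin.val_succ, Fin.val_castSucc]
  split_ifs <;> first | omega | norm_num

/-- The coordinate sum of a vertex is its position on the path, so the vertex set determines the
ordered path and hence `σ`. -/
theorem standardSimplex_injective :
    Function.Injective (standardSimplex : Equiv.Perm (Fin n) → _) := by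
  have hsum : ∀ (σ : Equiv.Perm (Fin n)) (k : Fin (n + 1)), ∑ j, pathVertex σ k j = (k : ℕ) := by
    intro σ k
    simp only [pathVertex_apply]
    rw [Equiv.sum_comp σ.symm (fun i : Fin n => if (i : ℕ) < k then (1 : ℝ) else 0),
      Finset.sum_boole, Fin.card_filter_val_lt, min_eq_right (Nat.lt_succ_iff.1 k.2)]
  intro σ τ h
  have hk : ∀ k, pathVertex σ k = pathVertex τ k := by
    intro k
    have hmem : pathVertex σ k ∈ Set.range (pathVertex τ) := by
      rw [range_pathVertex, ← h, ← range_pathVertex]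
      exact ⟨k, rfl⟩
    obtain ⟨m, hm⟩ := hmem
    have := hsum τ m
    rw [hm, hsum, Nat.cast_inj] at this
    rw [← hm, Fin.ext this]
  have hlt : ∀ j (k : Fin (n + 1)), (σ.symm j : ℕ) < k ↔ (τ.symm j : ℕ) < k := by
    intro j k
    have := congrArg (fun v : EuclideanSpace ℝ (Fin n) => v j) (hk k)
    simp only [pathVertex_apply] at this
    split_ifs at this with h1 h2 h2 <;>
      first | exact iff_of_true h1 h2 | exact iff_of_false h1 h2 | norm_num at this
  rw [← Equiv.symm_bijective.injective.eq_iff]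
  ext j
  have h1 := hlt j (σ.symm j).succ
  have h2 := hlt j (τ.symm j).succ
  simp only [Fin.val_succ] at h1 h2
  omega

theorem ncard_standardTriangulation : (standardTriangulation n).ncard = Nat.factorial n := by
  rw [standardTriangulation, ← Set.image_univ,
    Set.ncard_image_of_injective _ standardSimplex_injective, Set.ncard_univ,
    Nat.card_eq_fintype_card, Fintype.card_perm, Fintype.card_fin]

/-- The `k`-th largest coordinate of a point whose coordinates are sorted by `σ`, preceded by `1`
and followed by `0`. -/
noncomputable def sortedCoord (σ : Equiv.Perm (Fin n)) (x : EuclideanSpace ℝ (Fin n)) : ℕ → ℝ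
  | 0 => 1
  | k + 1 => if h : k < n then x (σ ⟨k, h⟩) else 0

theorem sortedCoord_symm_add_one (σ : Equiv.Perm (Fin n)) (x : EuclideanSpace ℝ (Fin n))
    (j : Fin n) : sortedCoord σ x (σ.symm j + 1) = x j := by
  simp [sortedCoord]

theorem antitone_sortedCoord {σ : Equiv.Perm (Fin n)} {x : EuclideanSpace ℝ (Fin n)}
    (hx : x ∈ unitCube n) (hσ : Antitone (x ∘ σ)) : Antitone (sortedCoord σ x) := by
  refine antitone_nat_of_succ_le fun k => ?_
  rcases k with _ | k
  · simp only [sortedCoord]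
    split_ifs
    · exact (hx _).2
    · exact zero_le_one
  · simp only [sortedCoord]
    split_ifs
    · exact hσ (Fin.mk_le_mk.2 (Nat.le_succ k))
    · omega
    · exact (hx _).1
    · exact le_rfl

theorem sum_sortedCoord_sub (σ : Equiv.Perm (Fin n)) (x : EuclideanSpace ℝ (Fin n)) :
    ∑ k : Fin (n + 1), (sortedCoord σ x k - sortedCoord σ x (k + 1)) = 1 := by
  rw [Fin.sum_univ_eq_sum_range (fun k => sortedCoord σ x k - sortedCoord σ x (k + 1)),
    Finset.sum_range_sub']
  simp [sortedCoord]

/-- The barycentric coordinates are the drops between consecutive sorted coordinates; in coordinate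
`j` they telescope from `x j` to the final `0`. -/
theorem sum_sortedCoord_smul_pathVertex (σ : Equiv.Perm (Fin n))
    (x : EuclideanSpace ℝ (Fin n)) :
    ∑ k : Fin (n + 1), (sortedCoord σ x k - sortedCoord σ x (k + 1)) • pathVertex σ k = x := by
  have key : ∀ (y : ℕ → ℝ) (m N : ℕ), ∑ k ∈ Finset.range N,
      (y k - y (k + 1)) * (if m < k then 1 else 0) = if m < N then y (m + 1) - y N else 0 := by
    intro y m N
    induction N with
    | zero => simp
    | succ N ih =>
      rw [Finset.sum_range_succ, ih]
      rcases lt_trichotomy m N with h | rfl | h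
      · rw [if_pos h, if_pos h, if_pos (by omega)]; ring
      · simp
      · rw [if_neg (by omega), if_neg (by omega), if_neg (by omega)]; ring
  ext j
  rw [WithLp.ofLp_sum, Finset.sum_apply]
  simp only [PiLp.smul_apply, smul_eq_mul, pathVertex_apply]
  rw [Fin.sum_univ_eq_sum_range (fun k => (sortedCoord σ x k - sortedCoord σ x (k + 1)) *
    if (σ.symm j : ℕ) < k then (1 : ℝ) else 0), key, if_pos (by omega), sortedCoord_symm_add_one]
  simp [sortedCoord]

theorem mem_convexHull_standardSimplex_iff {σ : Equiv.Perm (Fin n)}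
    {x : EuclideanSpace ℝ (Fin n)} :
    x ∈ convexHull ℝ (standardSimplex σ : Set (EuclideanSpace ℝ (Fin n))) ↔
      x ∈ unitCube n ∧ Antitone (x ∘ σ) := by
  constructor
  · refine fun hx => convexHull_min (t := {x | x ∈ unitCube n ∧ Antitone (x ∘ σ)}) ?_ ?_ hx
    · rw [← range_pathVertex]
      rintro _ ⟨k, rfl⟩
      refine ⟨(isCubeVertex_pathVertex σ k).mem_unitCube, fun i j hij => ?_⟩
      simp only [Function.comp_apply, pathVertex_apply, Equiv.symm_apply_apply]
      have : (i : ℕ) ≤ j := hij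
      split_ifs <;> first | omega | norm_num
    · intro x hx y hy a b ha hb hab
      refine ⟨convex_unitCube hx.1 hy.1 ha hb hab, fun i j hij => ?_⟩
      simp only [Function.comp_apply, PiLp.add_apply, PiLp.smul_apply, smul_eq_mul]
      exact add_le_add (mul_le_mul_of_nonneg_left (hx.2 hij) ha)
        (mul_le_mul_of_nonneg_left (hy.2 hij) hb)
  · rintro ⟨hx, hσ⟩
    rw [← sum_sortedCoord_smul_pathVertex σ x]
    refine (convex_convexHull ℝ _).sum_mem
      (fun k _ => sub_nonneg.2 (antitone_sortedCoord hx hσ (Nat.le_succ _)))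
      (sum_sortedCoord_sub σ x) fun k _ => subset_convexHull ℝ _ ?_
    rw [← range_pathVertex]
    exact ⟨k, rfl⟩

/-- The images of the first `k` indices form a lower set of size `k`; both directions compare
cardinalities with an initial segment. -/
theorem lt_iff_apply_lt_of_forall_lt (ρ : Equiv.Perm (Fin n)) {k : ℕ} (hk : k ≤ n)
    (h : ∀ i j : Fin n, (i : ℕ) < k → k ≤ j → ρ i < ρ j) (i : Fin n) :
    (i : ℕ) < k ↔ (ρ i : ℕ) < k := by
  set B : Finset (Fin n) := (Finset.univ.filter fun i : Fin n => (i : ℕ) < k).map ρ.toEmbedding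
    with hB
  have hcard : B.card = k := by
    rw [hB, Finset.card_map, Fin.card_filter_val_lt, min_eq_right hk]
  constructor
  · intro hi
    have hsub : Finset.Iic (ρ i) ⊆ B := by
      intro l hl
      obtain ⟨j, rfl⟩ := ρ.surjective l
      rw [hB, Finset.mem_map]
      refine ⟨j, Finset.mem_filter.2 ⟨Finset.mem_univ _, ?_⟩, rfl⟩
      by_contra hj
      exact absurd (h i j hi (not_lt.1 hj)) (not_lt.2 (Finset.mem_Iic.1 hl))
    have := Finset.card_le_card hsub
    rw [hcard, Fin.card_Iic] at this
    omega
  · intro hi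
    by_contra hik
    have hsub : B ⊆ Finset.Iio (ρ i) := by
      intro l hl
      rw [hB, Finset.mem_map] at hl
      obtain ⟨j, hj, rfl⟩ := hl
      exact Finset.mem_Iio.2 (h j i (Finset.mem_filter.1 hj).2 (not_lt.1 hik))
    have := Finset.card_le_card hsub
    rw [hcard, Fin.card_Iio] at this
    omega

/-- A strict drop after the `k` largest coordinates makes the set of these coordinates independent
of the sorting permutation. This gives the face-to-face property. -/
theorem pathVertex_eq_of_sortedCoord_ne {σ τ : Equiv.Perm (Fin n)}
    {x : EuclideanSpace ℝ (Fin n)} (hx : x ∈ unitCube n) (hσ : Antitone (x ∘ σ))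
    (hτ : Antitone (x ∘ τ)) {k : Fin (n + 1)}
    (hk : sortedCoord σ x k - sortedCoord σ x (k + 1) ≠ 0) : pathVertex σ k = pathVertex τ k := by
  have hanti := antitone_sortedCoord hx hσ
  have hlt : sortedCoord σ x (k + 1) < sortedCoord σ x k :=
    lt_of_le_of_ne (hanti (Nat.le_succ _)) fun e => hk (by rw [e, sub_self])
  have key := lt_iff_apply_lt_of_forall_lt (σ.trans τ.symm) (Nat.lt_succ_iff.1 k.2) ?_
  · ext j
    rw [pathVertex_apply, pathVertex_apply]
    have := key (σ.symm j)
    simp only [Equiv.trans_apply, Equiv.apply_symm_apply] at this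
    simp only [this]
  · intro i j hi hj
    by_contra hij
    have h1 := hτ (not_lt.1 hij)
    simp only [Function.comp_apply, Equiv.trans_apply, Equiv.apply_symm_apply] at h1
    have h2 := hanti (show (i : ℕ) + 1 ≤ k from hi)
    have h3 := hanti (show (k : ℕ) + 1 ≤ j + 1 by omega)
    have h4 := sortedCoord_symm_add_one σ x (σ i)
    have h5 := sortedCoord_symm_add_one σ x (σ j)
    rw [Equiv.symm_apply_apply] at h4 h5
    linarith

theorem isBinaryTriangulation_standardTriangulation :
    IsBinaryTriangulation (standardTriangulation n) where
  isBinarySimplex := by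
    rintro _ ⟨σ, rfl⟩
    exact isBinarySimplex_standardSimplex σ
  iUnion_eq := by
    ext x
    simp only [standardTriangulation, Set.mem_iUnion, Set.mem_range, exists_prop]
    constructor
    · rintro ⟨_, ⟨σ, rfl⟩, hx⟩
      exact (mem_convexHull_standardSimplex_iff.1 hx).1
    · intro hx
      -- `Tuple.sort` sorts increasingly, so the negated coordinates are sorted.
      refine ⟨_, ⟨Tuple.sort fun i => -x i, rfl⟩, mem_convexHull_standardSimplex_iff.2 ⟨hx, ?_⟩⟩
      intro i j hij
      exact neg_le_neg_iff.1 (Tuple.monotone_sort (fun i => -x i) hij)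
  face_to_face := by
    rintro _ ⟨σ, rfl⟩ _ ⟨τ, rfl⟩
    refine Set.Subset.antisymm ?_ (Set.subset_inter (convexHull_mono Set.inter_subset_left)
      (convexHull_mono Set.inter_subset_right))
    rintro x ⟨h1, h2⟩
    obtain ⟨hx, hσ⟩ := mem_convexHull_standardSimplex_iff.1 h1
    obtain ⟨-, hτ⟩ := mem_convexHull_standardSimplex_iff.1 h2
    -- In the `finsum` form only vertices of nonzero weight need to be common to both simplices.
    rw [← sum_sortedCoord_smul_pathVertex σ x, ← finsum_eq_sum_of_fintype]
    refine (convex_convexHull ℝ _).finsum_mem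
      (fun k => sub_nonneg.2 (antitone_sortedCoord hx hσ (Nat.le_succ _))) ?_
      fun k hk => subset_convexHull ℝ _ ?_
    · rw [finsum_eq_sum_of_fintype, sum_sortedCoord_sub]
    · rw [← range_pathVertex, ← range_pathVertex]
      exact ⟨⟨k, rfl⟩, ⟨k, (pathVertex_eq_of_sortedCoord_ne hx hσ hτ hk).symm⟩⟩

theorem isNonobtuseBinaryTriangulation_standardTriangulation :
    IsNonobtuseBinaryTriangulation (standardTriangulation n) := by
  refine ⟨isBinaryTriangulation_standardTriangulation, ?_⟩
  rintro _ ⟨σ, rfl⟩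
  exact isNonobtuse_standardSimplex σ

end StandardTriangulation

/-! ### Long diagonals and orthogonal paths -/

section PathSimplex

variable {n : ℕ}

theorem IsBinarySimplex.vectorSpan_range {S : Finset (EuclideanSpace ℝ (Fin n))}
    (hS : IsBinarySimplex S) :
    vectorSpan ℝ (Set.range ((↑) : S → EuclideanSpace ℝ (Fin n))) = ⊤ :=
  vectorSpan_eq_top_of_card hS.affineIndependent (by rw [Fintype.card_coe, hS.card_eq])

open Classical in
theorem IsBinarySimplex.exists_isDualFamily {S : Finset (EuclideanSpace ℝ (Fin n))}
    (hS : IsBinarySimplex S) :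
    ∃ g, IsDualFamily ((↑) : S → EuclideanSpace ℝ (Fin n)) g :=
  CubeTriangulation.exists_isDualFamily hS.affineIndependent
    (by rw [Fintype.card_coe, hS.card_eq])

theorem inner_mul_inner_nonpos_of_inner_eq_zero {S : Finset (EuclideanSpace ℝ (Fin n))}
    (hS : IsBinarySimplex S) (hno : IsNonobtuse S) {o w p q : EuclideanSpace ℝ (Fin n)}
    (ho : o ∈ S) (hw : w ∈ S) (hp : p ∈ S) (hq : q ∈ S) (h0 : inner ℝ (o - p) (w - p) = 0) :
    inner ℝ (o - p) (q - p) * inner ℝ (w - p) (q - p) ≤ 0 := by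
  classical
  obtain ⟨g, hg⟩ := hS.exists_isDualFamily
  have hneg := (hg.isNonobtuse_iff Subtype.val_injective hS.vectorSpan_range
    (by simp)).1 hno
  set a := o - p with ha
  set d := q - p with hd
  -- Up to the factor `‖d‖²`, this is the component of `a` orthogonal to `d`. It pairs to zero with
  -- `d`, nonnegatively with `a` by Cauchy–Schwarz, and by `h0` its pairing with `w - p` is minus
  -- the product to be bounded.
  have hx : inner ℝ d d • a - inner ℝ a d • d ∈ vectorSpan ℝ
      (((↑) : S → EuclideanSpace ℝ (Fin n)) '' {⟨o, ho⟩, ⟨p, hp⟩, ⟨q, hq⟩}) := by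
    refine Submodule.sub_mem _ (Submodule.smul_mem _ _ ?_) (Submodule.smul_mem _ _ ?_)
    · exact vsub_mem_vectorSpan ℝ ⟨⟨o, ho⟩, by simp, rfl⟩ ⟨⟨p, hp⟩, by simp, rfl⟩
    · exact vsub_mem_vectorSpan ℝ ⟨⟨q, hq⟩, by simp, rfl⟩ ⟨⟨p, hp⟩, by simp, rfl⟩
  have key := hg.inner_nonneg hS.vectorSpan_range hneg hx (k := ⟨p, hp⟩) ?_ ⟨w, hw⟩
  · rw [inner_sub_left, real_inner_smul_left, real_inner_smul_left, h0, mul_zero,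
      real_inner_comm _ d] at key
    linarith
  · rintro i (rfl | rfl | rfl)
    · change 0 ≤ inner ℝ _ a
      rw [inner_sub_left, real_inner_smul_left, real_inner_smul_left, real_inner_comm a d]
      have := real_inner_mul_inner_self_le a d
      linarith
    · simp
    · change 0 ≤ inner ℝ _ d
      rw [inner_sub_left, real_inner_smul_left, real_inner_smul_left]
      linarith

theorem IsCubeVertex.ne_iff {v w : EuclideanSpace ℝ (Fin n)} (hv : IsCubeVertex v)
    (hw : IsCubeVertex w) (i : Fin n) : v i ≠ w i ↔ v i = 1 - w i := by
  rcases hv i with h | h <;> rcases hw i with h' | h' <;> norm_num [h, h']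

/-- In a nonobtuse binary simplex that contains a long diagonal, the vertices form a chain if cube
vertices are ordered by the set of coordinates in which they differ from `o`. -/
theorem chain_of_antipodal {S : Finset (EuclideanSpace ℝ (Fin n))}
    (hS : IsBinarySimplex S) (hno : IsNonobtuse S) {o w p q : EuclideanSpace ℝ (Fin n)}
    (ho : o ∈ S) (hw : w ∈ S) (how : ∀ i, w i = 1 - o i) (hp : p ∈ S) (hq : q ∈ S) :
    (∀ i, p i ≠ o i → q i = p i) ∨ ∀ i, q i ≠ o i → p i = q i := by
  have vo := hS.isCubeVertex o ho
  have vp := hS.isCubeVertex p hp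
  have vq := hS.isCubeVertex q hq
  have key := inner_mul_inner_nonpos_of_inner_eq_zero hS hno ho hw hp hq ?_
  · have h1 : ∀ i, 0 ≤ (o - p) i * (q - p) i := by
      intro i
      simp only [PiLp.sub_apply]
      rcases vo i with h | h <;> rcases vp i with h' | h' <;> rcases vq i with h'' | h'' <;>
        norm_num [h, h', h'']
    have h2 : ∀ i, 0 ≤ (w - p) i * (q - p) i := by
      intro i
      simp only [PiLp.sub_apply, how]
      rcases vo i with h | h <;> rcases vp i with h' | h' <;> rcases vq i with h'' | h'' <;>
        norm_num [h, h', h'']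
    rw [inner_eq_sum_mul, inner_eq_sum_mul] at key
    have hz := le_antisymm key (mul_nonneg (Finset.sum_nonneg fun i _ => h1 i)
      (Finset.sum_nonneg fun i _ => h2 i))
    rcases mul_eq_zero.1 hz with hz | hz
    · left
      intro i hi
      have := (Finset.sum_eq_zero_iff_of_nonneg fun i _ => h1 i).1 hz i (Finset.mem_univ i)
      rcases mul_eq_zero.1 this with h | h
      · exact absurd (sub_eq_zero.1 h).symm hi
      · exact sub_eq_zero.1 h
    · right
      intro i hi
      have := (Finset.sum_eq_zero_iff_of_nonneg fun i _ => h2 i).1 hz i (Finset.mem_univ i)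
      rcases mul_eq_zero.1 this with h | h
      · have h3 : w i = p i := sub_eq_zero.1 h
        rw [← h3, how, ((vq.ne_iff vo) i).1 hi]
      · exact (sub_eq_zero.1 h).symm
  · rw [inner_eq_sum_mul]
    refine Finset.sum_eq_zero fun i _ => ?_
    simp only [PiLp.sub_apply, how]
    rcases vo i with h | h <;> rcases vp i with h' | h' <;> norm_num [h, h']

/-- In a chain, the number of coordinates differing from `o` determines the vertex, so sorting by it
gives the path. A coordinate that has left its value in `o` never changes again, hence distinct
edges have disjoint supports. The start `o` is recorded because uniqueness needs the path to begin
at a given vertex. -/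
theorem exists_path_of_antipodal {S : Finset (EuclideanSpace ℝ (Fin n))}
    (hS : IsBinarySimplex S) (hno : IsNonobtuse S) {o w : EuclideanSpace ℝ (Fin n)}
    (ho : o ∈ S) (hw : w ∈ S) (how : ∀ i, w i = 1 - o i) :
    ∃ v : Fin (n + 1) → EuclideanSpace ℝ (Fin n), v 0 = o ∧
      Function.Injective v ∧ Set.range v = (S : Set (EuclideanSpace ℝ (Fin n))) ∧
        ∀ i j : Fin n, i ≠ j →
          inner ℝ (v i.succ - v i.castSucc) (v j.succ - v j.castSucc) = 0 := by
  classical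
  set R : EuclideanSpace ℝ (Fin n) → EuclideanSpace ℝ (Fin n) → Prop :=
    fun p q => ∀ i, p i ≠ o i → q i = p i with hR
  set φ : EuclideanSpace ℝ (Fin n) → Finset (Fin n) :=
    fun p => Finset.univ.filter fun i => p i ≠ o i with hφ
  have htotal : ∀ p ∈ S, ∀ q ∈ S, R p q ∨ R q p := fun p hp q hq =>
    chain_of_antipodal hS hno ho hw how hp hq
  have hsub : ∀ p q, R p q → φ p ⊆ φ q := by
    intro p q h i hi
    simp only [hφ, Finset.mem_filter, Finset.mem_univ, true_and] at hi ⊢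
    rwa [h i hi]
  have heq : ∀ p q, R p q → (φ p).card = (φ q).card → p = q := by
    intro p q h hc
    have h2 := Finset.eq_of_subset_of_card_le (hsub p q h) hc.ge
    ext i
    by_cases hi : p i = o i
    · have : i ∉ φ q := by rw [← h2]; simp [hφ, hi]
      simp only [hφ, Finset.mem_filter, Finset.mem_univ, true_and, not_not] at this
      rw [hi, this]
    · exact (h i hi).symm
  have hinj : Set.InjOn (fun p => (φ p).card) S := by
    intro p hp q hq hpq
    rcases htotal p hp q hq with h | h
    · exact heq p q h hpq
    · exact (heq q p h hpq.symm).symm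
  have hcard : (S.image fun p => (φ p).card).card = n + 1 := by
    rw [Finset.card_image_of_injOn hinj, hS.card_eq]
  set e := (S.image fun p => (φ p).card).orderEmbOfFin hcard with he
  have hex : ∀ k, ∃ p ∈ S, (φ p).card = e k := fun k =>
    Finset.mem_image.1 (Finset.orderEmbOfFin_mem _ hcard k)
  choose v hvS hv using hex
  have hvinj : Function.Injective v := fun k l hkl =>
    e.injective (by rw [← hv, ← hv, hkl])
  have hrange : Set.range v = (S : Set (EuclideanSpace ℝ (Fin n))) := by
    have h1 : Finset.univ.image v = S := by
      refine Finset.eq_of_subset_of_card_le ?_ ?_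
      · intro p hp
        obtain ⟨k, -, rfl⟩ := Finset.mem_image.1 hp
        exact hvS k
      · rw [Finset.card_image_of_injective _ hvinj, hS.card_eq, Finset.card_univ, Fintype.card_fin]
    rw [← h1]
    simp
  have hmono : ∀ k l, k ≤ l → R (v k) (v l) := by
    intro k l hkl
    rcases htotal _ (hvS k) _ (hvS l) with h | h
    · exact h
    · have h1 := Finset.card_le_card (hsub _ _ h)
      rw [hv, hv, e.le_iff_le] at h1
      rw [le_antisymm hkl h1]
      exact fun _ _ => rfl
  have hlt : ∀ i j : Fin n, i < j →
      inner ℝ (v i.succ - v i.castSucc) (v j.succ - v j.castSucc) = 0 := by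
    intro i j hij
    rw [inner_eq_sum_mul]
    refine Finset.sum_eq_zero fun c _ => ?_
    simp only [PiLp.sub_apply]
    by_cases hc : v i.succ c = o c
    · have : v i.castSucc c = o c := by
        by_contra h
        exact h ((hmono _ _ (Fin.castSucc_lt_succ).le c h).symm.trans hc)
      rw [hc, this, sub_self, zero_mul]
    · have h1 : i.succ ≤ j.castSucc := Fin.succ_le_castSucc_iff.2 hij
      rw [hmono _ _ h1 c hc, hmono _ _ (h1.trans (Fin.castSucc_lt_succ).le) c hc, sub_self,
        mul_zero]
  refine ⟨v, ?_, hvinj, hrange, fun i j hij => ?_⟩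
  · obtain ⟨k, hk⟩ : o ∈ Set.range v := hrange ▸ ho
    have h0 := hmono 0 k (Fin.zero_le k)
    rw [hk] at h0
    ext i
    by_contra h
    exact h (h0 i h).symm
  · rcases lt_or_gt_of_ne hij with h | h
    · exact hlt i j h
    · rw [real_inner_comm]
      exact hlt j i h

/-- The steps of a path of cube vertices with `n` mutually orthogonal edges are parallel to the
coordinate axes. -/
theorem exists_perm_of_orthogonal_path {v : Fin (n + 1) → EuclideanSpace ℝ (Fin n)}
    (hv : ∀ k, IsCubeVertex (v k)) (hinj : Function.Injective v)
    (horth : ∀ i j : Fin n, i ≠ j →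
      inner ℝ (v i.succ - v i.castSucc) (v j.succ - v j.castSucc) = 0) :
    ∃ σ : Equiv.Perm (Fin n), ∀ k j,
      v k j = if (σ.symm j : ℕ) < k then 1 - v 0 j else v 0 j := by
  set d : Fin n → EuclideanSpace ℝ (Fin n) := fun i => v i.succ - v i.castSucc with hd
  have hsq : ∀ i j, d i j ≠ 0 → d i j * d i j = 1 := by
    intro i j
    simp only [hd, PiLp.sub_apply]
    rcases hv i.succ j with h | h <;> rcases hv i.castSucc j with h' | h' <;> norm_num [h, h']
  have hne : ∀ i, ∃ j, d i j ≠ 0 := by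
    intro i
    by_contra! h
    have h0 : d i = 0 := by
      ext j
      exact h j
    exact (Fin.castSucc_lt_succ (i := i)).ne' (hinj (sub_eq_zero.1 h0))
  choose τ hτ using hne
  have hge : ∀ i ∈ Finset.univ, (1 : ℝ) ≤ inner ℝ (d i) (d i) := by
    intro i _
    rw [inner_eq_sum_mul, ← hsq i _ (hτ i)]
    exact Finset.single_le_sum (f := fun j => d i j * d i j) (fun j _ => mul_self_nonneg _)
      (Finset.mem_univ _)
  have hsum : ∑ i, d i = v (Fin.last n) - v 0 := by
    have h1 := Fin.sum_univ_succ v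
    rw [Fin.sum_univ_castSucc] at h1
    rw [hd, Finset.sum_sub_distrib, sub_eq_sub_iff_add_eq_add, add_comm, ← h1, add_comm]
  -- By Pythagoras the sum is the squared distance of two cube vertices, at most `n`. As each of the
  -- `n` terms is at least `1`, every edge has length exactly `1`.
  have hle : ∑ i, inner ℝ (d i) (d i) ≤ ∑ _i : Fin n, (1 : ℝ) := by
    have h1 : ∑ i, inner ℝ (d i) (d i) = inner ℝ (∑ i, d i) (∑ i, d i) := by
      rw [sum_inner]
      refine Finset.sum_congr rfl fun i _ => ?_
      rw [inner_sum, Finset.sum_eq_single i (fun j _ hji => horth i j hji.symm) (by simp)]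
    rw [h1, hsum, inner_eq_sum_mul]
    refine Finset.sum_le_sum fun j _ => ?_
    simp only [PiLp.sub_apply]
    rcases hv (Fin.last n) j with h | h <;> rcases hv 0 j with h' | h' <;> norm_num [h, h']
  have hone : ∀ i, inner ℝ (d i) (d i) = 1 := fun i =>
    ((Finset.sum_eq_sum_iff_of_le hge).1 (le_antisymm (Finset.sum_le_sum hge) hle) i
      (Finset.mem_univ i)).symm
  have hzero : ∀ i j, j ≠ τ i → d i j = 0 := by
    intro i j hj
    have h1 := hone i
    rw [inner_eq_sum_mul, ← Finset.add_sum_erase _ _ (Finset.mem_univ (τ i)), hsq i _ (hτ i),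
      add_eq_left, Finset.sum_eq_zero_iff_of_nonneg fun j _ => mul_self_nonneg _] at h1
    exact mul_self_eq_zero.1 (h1 j (Finset.mem_erase.2 ⟨hj, Finset.mem_univ j⟩))
  have hτinj : Function.Injective τ := by
    intro i j hij
    by_contra hne
    have h1 := horth i j hne
    change inner ℝ (d i) (d j) = 0 at h1
    rw [inner_eq_sum_mul, Finset.sum_eq_single (τ i)
      (fun l _ hl => by rw [hzero i l hl, zero_mul]) (by simp)] at h1
    exact mul_ne_zero (hτ i) (hij ▸ hτ j) h1
  refine ⟨Equiv.ofBijective τ (Finite.injective_iff_bijective.1 hτinj), fun k j => ?_⟩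
  set σ := Equiv.ofBijective τ (Finite.injective_iff_bijective.1 hτinj) with hσ
  induction k using Fin.induction with
  | zero => simp
  | succ k ih =>
    by_cases hj : j = τ k
    · have hs : σ.symm j = k := by rw [Equiv.symm_apply_eq, hj]; rfl
      have h1 : v k.succ j ≠ v k.castSucc j := fun e => hτ k (by
        rw [← hj]; exact sub_eq_zero.2 e)
      rw [hs] at ih ⊢
      rw [if_neg (by simp)] at ih
      rw [ih] at h1
      rw [if_pos (by simp), ((hv _).ne_iff (hv 0) j).1 h1]
    · have hs : σ.symm j ≠ k := by
        intro e
        rw [Equiv.symm_apply_eq] at e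
        exact hj e
      have hs' : (σ.symm j : ℕ) ≠ k := fun e => hs (Fin.ext e)
      have h1 : v k.succ j = v k.castSucc j := sub_eq_zero.1 (hzero k j hj)
      rw [h1, ih]
      simp only [Fin.val_succ, Fin.val_castSucc]
      split_ifs <;> first | rfl | omega

end PathSimplex

/-! ### Triangulations determined by the simplices at one edge -/

section Uniqueness

variable {n : ℕ}

theorem finite_isCubeVertex : {v : EuclideanSpace ℝ (Fin n) | IsCubeVertex v}.Finite := by
  have h : {f : Fin n → ℝ | ∀ i, f i ∈ ({0, 1} : Set ℝ)}.Finite :=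
    Set.Finite.pi' fun _ => Set.toFinite _
  exact h.preimage (WithLp.ofLp_injective 2).injOn

theorem IsBinaryTriangulation.finite {T : Set (Finset (EuclideanSpace ℝ (Fin n)))}
    (hT : IsBinaryTriangulation T) : T.Finite := by
  refine (finite_isCubeVertex (n := n)).toFinset.powerset.finite_toSet.subset fun S hS => ?_
  rw [Finset.mem_coe, Finset.mem_powerset]
  exact fun v hv => (Set.Finite.mem_toFinset _).2 ((hT.isBinarySimplex S hS).isCubeVertex v hv)

theorem IsBinarySimplex.mem_of_mem_convexHull {S : Finset (EuclideanSpace ℝ (Fin n))}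
    (hS : IsBinarySimplex S) {s : Set (EuclideanSpace ℝ (Fin n))} (hs : s ⊆ S)
    {c : EuclideanSpace ℝ (Fin n) → ℝ} (hc : ∑ u ∈ S, c u = 1)
    (hx : ∑ u ∈ S, c u • u ∈ convexHull ℝ s) {v : EuclideanSpace ℝ (Fin n)} (hv : v ∈ S)
    (hcv : c v ≠ 0) : v ∈ s := by
  classical
  obtain ⟨g, hg⟩ := hS.exists_isDualFamily
  have himage : ((↑) : S → EuclideanSpace ℝ (Fin n)) '' ((↑) ⁻¹' s) = s := by
    exact Set.image_preimage_eq_of_subset (by simpa using hs)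
  rw [← Finset.sum_coe_sort] at hc hx
  rw [← himage] at hx
  exact hg.mem_of_mem_convexHull hc hx (i := ⟨v, hv⟩) hcv

theorem IsBinaryTriangulation.mem_of_mem_convexHull
    {T : Set (Finset (EuclideanSpace ℝ (Fin n)))} (hT : IsBinaryTriangulation T)
    {S S' : Finset (EuclideanSpace ℝ (Fin n))} (hS : S ∈ T) (hS' : S' ∈ T)
    {c : EuclideanSpace ℝ (Fin n) → ℝ} (hc0 : ∀ u ∈ S, 0 ≤ c u) (hc : ∑ u ∈ S, c u = 1)
    (hx : ∑ u ∈ S, c u • u ∈ convexHull ℝ (S' : Set (EuclideanSpace ℝ (Fin n))))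
    {v : EuclideanSpace ℝ (Fin n)} (hv : v ∈ S) (hcv : c v ≠ 0) : v ∈ S' := by
  have h1 : ∑ u ∈ S, c u • u ∈ convexHull ℝ (S : Set (EuclideanSpace ℝ (Fin n))) :=
    (convex_convexHull ℝ _).sum_mem hc0 hc fun u hu => subset_convexHull ℝ _ hu
  have h2 := (hT.face_to_face S hS S' hS').subset ⟨h1, hx⟩
  exact ((hT.isBinarySimplex S hS).mem_of_mem_convexHull Set.inter_subset_left hc h2 hv hcv).2

/-- An interior point of `S` forces all vertices of `S` into `S'`, and both simplices have `n + 1`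
vertices. -/
theorem IsBinaryTriangulation.eq_of_mem_convexHull
    {T : Set (Finset (EuclideanSpace ℝ (Fin n)))} (hT : IsBinaryTriangulation T)
    {S S' : Finset (EuclideanSpace ℝ (Fin n))} (hS : S ∈ T) (hS' : S' ∈ T)
    {c : EuclideanSpace ℝ (Fin n) → ℝ} (hc0 : ∀ u ∈ S, 0 < c u) (hc : ∑ u ∈ S, c u = 1)
    (hx : ∑ u ∈ S, c u • u ∈ convexHull ℝ (S' : Set (EuclideanSpace ℝ (Fin n)))) : S = S' := by
  refine Finset.eq_of_subset_of_card_le (fun v hv => hT.mem_of_mem_convexHull hS hS'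
    (fun u hu => (hc0 u hu).le) hc hx hv (hc0 v hv).ne') ?_
  rw [(hT.isBinarySimplex S hS).card_eq, (hT.isBinarySimplex S' hS').card_eq]

theorem IsBinaryTriangulation.exists_mem_convexHull
    {T : Set (Finset (EuclideanSpace ℝ (Fin n)))} (hT : IsBinaryTriangulation T)
    {x : EuclideanSpace ℝ (Fin n)} (hx : x ∈ unitCube n) :
    ∃ S ∈ T, x ∈ convexHull ℝ (S : Set (EuclideanSpace ℝ (Fin n))) := by
  rw [← hT.iUnion_eq] at hx
  simpa using hx

theorem IsBinarySimplex.convexHull_subset {S : Finset (EuclideanSpace ℝ (Fin n))}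
    (hS : IsBinarySimplex S) :
    convexHull ℝ (S : Set (EuclideanSpace ℝ (Fin n))) ⊆ unitCube n :=
  convexHull_min (fun v hv => (hS.isCubeVertex v hv).mem_unitCube) convex_unitCube

/-- The barycentric coordinates of a point near the midpoint of the edge from `a` to `w`. -/
noncomputable def nearMidpointWeight [DecidableEq (EuclideanSpace ℝ (Fin n))]
    (a w : EuclideanSpace ℝ (Fin n)) (t : ℝ) (u : EuclideanSpace ℝ (Fin n)) : ℝ :=
  (1 - t) * ((if u = a then 1 / 2 else 0) + if u = w then 1 / 2 else 0) + t * (n + 1 : ℝ)⁻¹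

theorem sum_nearMidpointWeight [DecidableEq (EuclideanSpace ℝ (Fin n))]
    {S : Finset (EuclideanSpace ℝ (Fin n))} (hS : S.card = n + 1)
    {a w : EuclideanSpace ℝ (Fin n)} (ha : a ∈ S) (hw : w ∈ S) (t : ℝ) :
    ∑ u ∈ S, nearMidpointWeight a w t u = 1 := by
  simp only [nearMidpointWeight, Finset.sum_add_distrib, ← Finset.mul_sum, Finset.sum_ite_eq',
    ha, hw, if_true, Finset.sum_const, hS, nsmul_eq_mul]
  have : (n + 1 : ℝ) ≠ 0 := by positivity
  push_cast
  field_simp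
  ring

theorem nearMidpointWeight_nonneg [DecidableEq (EuclideanSpace ℝ (Fin n))]
    (a w : EuclideanSpace ℝ (Fin n)) {t : ℝ} (h0 : 0 ≤ t) (h1 : t ≤ 1)
    (u : EuclideanSpace ℝ (Fin n)) : 0 ≤ nearMidpointWeight a w t u := by
  have := sub_nonneg.2 h1
  unfold nearMidpointWeight
  positivity

theorem nearMidpointWeight_pos [DecidableEq (EuclideanSpace ℝ (Fin n))]
    (a w : EuclideanSpace ℝ (Fin n)) {t : ℝ} (h0 : 0 < t) (h1 : t ≤ 1)
    (u : EuclideanSpace ℝ (Fin n)) : 0 < nearMidpointWeight a w t u := by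
  have := sub_nonneg.2 h1
  unfold nearMidpointWeight
  positivity

theorem sum_nearMidpointWeight_zero_smul [DecidableEq (EuclideanSpace ℝ (Fin n))]
    {S : Finset (EuclideanSpace ℝ (Fin n))}
    {a w : EuclideanSpace ℝ (Fin n)} (ha : a ∈ S) (hw : w ∈ S) :
    ∑ u ∈ S, nearMidpointWeight a w 0 u • u = (1 / 2 : ℝ) • a + (1 / 2 : ℝ) • w := by
  simp [nearMidpointWeight, add_smul, Finset.sum_add_distrib, ite_smul, ha, hw]

theorem IsBinaryTriangulation.mem_of_midpoint_mem
    {T : Set (Finset (EuclideanSpace ℝ (Fin n)))} (hT : IsBinaryTriangulation T)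
    {a w : EuclideanSpace ℝ (Fin n)} {S S' : Finset (EuclideanSpace ℝ (Fin n))} (hS : S ∈ T)
    (ha : a ∈ S) (hw : w ∈ S) (hS' : S' ∈ T)
    (hx : (1 / 2 : ℝ) • a + (1 / 2 : ℝ) • w ∈
      convexHull ℝ (S' : Set (EuclideanSpace ℝ (Fin n)))) : a ∈ S' ∧ w ∈ S' := by
  classical
  rw [← sum_nearMidpointWeight_zero_smul ha hw] at hx
  have hc := sum_nearMidpointWeight (hT.isBinarySimplex S hS).card_eq ha hw 0
  have h0 := fun u (_ : u ∈ S) => nearMidpointWeight_nonneg a w le_rfl zero_le_one u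
  constructor
  · refine hT.mem_of_mem_convexHull hS hS' h0 hc hx ha (ne_of_gt ?_)
    unfold nearMidpointWeight
    rw [if_pos rfl]
    positivity
  · refine hT.mem_of_mem_convexHull hS hS' h0 hc hx hw (ne_of_gt ?_)
    unfold nearMidpointWeight
    rw [if_pos (rfl : w = w)]
    positivity

/-- A triangulation that contains the edge from `a` to `w` is determined by the simplices that
may contain this edge, provided that these form a triangulation themselves. -/
theorem IsBinaryTriangulation.eq_of_edge
    {T T₀ : Set (Finset (EuclideanSpace ℝ (Fin n)))} (hT : IsBinaryTriangulation T)
    (hT₀ : IsBinaryTriangulation T₀) {a w : EuclideanSpace ℝ (Fin n)}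
    (hmem : ∀ S ∈ T₀, a ∈ S ∧ w ∈ S) (hsub : ∀ S ∈ T, a ∈ S → w ∈ S → S ∈ T₀)
    {S : Finset (EuclideanSpace ℝ (Fin n))} (hS : S ∈ T) (ha : a ∈ S) (hw : w ∈ S) :
    T = T₀ := by
  classical
  have hle : T₀ ⊆ T := by
    intro S₀ hS₀
    obtain ⟨ha₀, hw₀⟩ := hmem S₀ hS₀
    have hcard := (hT₀.isBinarySimplex S₀ hS₀).card_eq
    -- The simplices of `T` missing the midpoint have a closed union, as they are finitely many.
    -- Points of `S₀` close to the midpoint avoid it.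
    set U : Set (EuclideanSpace ℝ (Fin n)) :=
      ⋃ S' ∈ {S' ∈ T | (1 / 2 : ℝ) • a + (1 / 2 : ℝ) • w ∉
        convexHull ℝ (S' : Set (EuclideanSpace ℝ (Fin n)))},
      convexHull ℝ (S' : Set (EuclideanSpace ℝ (Fin n))) with hU
    have hclosed : IsClosed U := (hT.finite.subset (Set.sep_subset _ _)).isClosed_biUnion
      fun S' _ => S'.finite_toSet.isClosed_convexHull ℝ
    set f : ℝ → EuclideanSpace ℝ (Fin n) := fun t => ∑ u ∈ S₀, nearMidpointWeight a w t u • u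
      with hf
    have hcont : Continuous f := by
      simp only [hf, nearMidpointWeight]
      fun_prop
    have hf0 : f 0 ∈ Uᶜ := by
      simp only [hf, sum_nearMidpointWeight_zero_smul ha₀ hw₀]
      intro h
      obtain ⟨S', hS', hx⟩ := Set.mem_iUnion₂.1 h
      exact hS'.2 hx
    have hev : ∀ᶠ t in nhdsWithin 0 (Set.Ioi 0), f t ∈ Uᶜ ∧ t ∈ Set.Ioc (0 : ℝ) 1 :=
      ((hcont.continuousAt.eventually (hclosed.isOpen_compl.mem_nhds hf0)).filter_mono
        nhdsWithin_le_nhds).and (Ioc_mem_nhdsGT zero_lt_one)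
    -- For `0 < t ≤ 1` all weights are positive, so `f t` is interior to `S₀`. A simplex of `T`
    -- covering it contains the midpoint, hence the edge, hence lies in `T₀` and equals `S₀`.
    obtain ⟨t, htU, ht0, ht1⟩ := hev.exists
    have hsum := sum_nearMidpointWeight hcard ha₀ hw₀ t
    have hx : f t ∈ unitCube n := (hT₀.isBinarySimplex S₀ hS₀).convexHull_subset
      ((convex_convexHull ℝ _).sum_mem (fun u _ => nearMidpointWeight_nonneg a w ht0.le ht1 u)
        hsum fun u hu => subset_convexHull ℝ _ hu)
    obtain ⟨S', hS', hxS'⟩ := hT.exists_mem_convexHull hx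
    have hmid : (1 / 2 : ℝ) • a + (1 / 2 : ℝ) • w ∈
        convexHull ℝ (S' : Set (EuclideanSpace ℝ (Fin n))) := by
      by_contra h
      exact htU (Set.mem_iUnion₂.2 ⟨S', ⟨hS', h⟩, hxS'⟩)
    obtain ⟨ha', hw'⟩ := hT.mem_of_midpoint_mem hS ha hw hS' hmid
    rw [hT₀.eq_of_mem_convexHull hS₀ (hsub S' hS' ha' hw')
      (fun u _ => nearMidpointWeight_pos a w ht0 ht1 u) hsum hxS']
    exact hS'
  refine Set.Subset.antisymm (fun S' hS' => ?_) hle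
  have hcard := (hT.isBinarySimplex S' hS').card_eq
  -- The centroid of `S'` lies in some simplex of `T₀ ⊆ T`, which must then be `S'` itself.
  have hsum : ∑ _u ∈ S', (n + 1 : ℝ)⁻¹ = 1 := by
    rw [Finset.sum_const, hcard, nsmul_eq_mul, Nat.cast_succ]
    exact mul_inv_cancel₀ (by positivity)
  obtain ⟨S₀, hS₀, hx⟩ := hT₀.exists_mem_convexHull
    ((hT.isBinarySimplex S' hS').convexHull_subset ((convex_convexHull ℝ _).sum_mem
      (fun u _ => by positivity) hsum fun u hu => subset_convexHull ℝ _ hu))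
  rw [hT.eq_of_mem_convexHull hS' (hle hS₀) (fun u _ => by positivity) hsum hx]
  exact hS₀

end Uniqueness

/-! ### Transport by symmetries of the cube -/

section Symmetry

variable {n : ℕ}

theorem IsDualFamily.map_affineIsometryEquiv {ι : Type*} [DecidableEq ι]
    {p g : ι → EuclideanSpace ℝ (Fin n)} (h : IsDualFamily p g)
    (e : EuclideanSpace ℝ (Fin n) ≃ᵃⁱ[ℝ] EuclideanSpace ℝ (Fin n)) :
    IsDualFamily (e ∘ p) (e.linearIsometryEquiv ∘ g) := by
  intro i j k
  rw [Function.comp_apply, Function.comp_apply, Function.comp_apply, ← vsub_eq_sub,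
    ← e.map_vsub, LinearIsometryEquiv.inner_map_map, vsub_eq_sub, h]

/-- An isometry of the space is affine, and its linear part carries gradients to gradients with the
same inner products. -/
theorem IsBinarySimplex.map_isometryEquiv
    {g : EuclideanSpace ℝ (Fin n) ≃ᵢ EuclideanSpace ℝ (Fin n)}
    (hg : ∀ v, IsCubeVertex v → IsCubeVertex (g v)) {S : Finset (EuclideanSpace ℝ (Fin n))}
    (hS : IsBinarySimplex S) : IsBinarySimplex (S.map g.toEquiv.toEmbedding) ∧
      (IsNonobtuse S → IsNonobtuse (S.map g.toEquiv.toEmbedding)) := by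
  classical
  obtain ⟨d, hd⟩ := hS.exists_isDualFamily
  have hd' := hd.map_affineIsometryEquiv g.toRealAffineIsometryEquiv
  have hc : Fintype.card S = n + 1 := by rw [Fintype.card_coe, hS.card_eq]
  have hrange : Set.range (g.toRealAffineIsometryEquiv ∘ ((↑) : S → EuclideanSpace ℝ (Fin n))) =
      (S.map g.toEquiv.toEmbedding : Finset (EuclideanSpace ℝ (Fin n))) := by
    rw [Set.range_comp, Finset.coe_map]
    simp
  refine ⟨isBinarySimplex_of_range hc hd'.affineIndependent
    (fun u => by simpa using hg u (hS.isCubeVertex u u.2)) hrange, fun hno => ?_⟩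
  rw [hd'.isNonobtuse_iff hd'.affineIndependent.injective
    (vectorSpan_eq_top_of_card hd'.affineIndependent hc) hrange]
  intro i j hij
  rw [Function.comp_apply, Function.comp_apply, LinearIsometryEquiv.inner_map_map]
  exact (hd.isNonobtuse_iff Subtype.val_injective hS.vectorSpan_range (by simp)).1 hno i j hij

theorem convexHull_map_isometryEquiv (g : EuclideanSpace ℝ (Fin n) ≃ᵢ EuclideanSpace ℝ (Fin n))
    (s : Set (EuclideanSpace ℝ (Fin n))) : convexHull ℝ (g '' s) = g '' convexHull ℝ s := by
  have h := g.toRealAffineIsometryEquiv.toAffineEquiv.toAffineMap.image_convexHull s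
  simpa using h.symm

theorem IsNonobtuseBinaryTriangulation.map_isometryEquiv
    {g : EuclideanSpace ℝ (Fin n) ≃ᵢ EuclideanSpace ℝ (Fin n)} (hg : IsCubeSymmetry g)
    (hv : ∀ v, IsCubeVertex v → IsCubeVertex (g v))
    {T : Set (Finset (EuclideanSpace ℝ (Fin n)))} (hT : IsNonobtuseBinaryTriangulation T) :
    IsNonobtuseBinaryTriangulation (mapTriangulation g T) := by
  have hcoe : ∀ S : Finset (EuclideanSpace ℝ (Fin n)),
      (S.map g.toEquiv.toEmbedding : Set (EuclideanSpace ℝ (Fin n))) = g '' S := fun S => by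
    rw [Finset.coe_map]
    rfl
  refine ⟨⟨?_, ?_, ?_⟩, ?_⟩
  · rintro _ ⟨S, hS, rfl⟩
    exact ((hT.1.isBinarySimplex S hS).map_isometryEquiv hv).1
  · rw [mapTriangulation, Set.biUnion_image]
    simp only [hcoe, convexHull_map_isometryEquiv, ← Set.image_iUnion₂]
    rw [hT.1.iUnion_eq]
    exact hg
  · rintro _ ⟨S, hS, rfl⟩ _ ⟨S', hS', rfl⟩
    simp only [hcoe]
    rw [← Set.image_inter g.injective, convexHull_map_isometryEquiv, convexHull_map_isometryEquiv,
      convexHull_map_isometryEquiv, ← hT.1.face_to_face S hS S' hS', Set.image_inter g.injective]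
  · rintro _ ⟨S, hS, rfl⟩
    exact ((hT.1.isBinarySimplex S hS).map_isometryEquiv hv).2 (hT.2 S hS)

/-- The symmetry of the cube that moves the origin to the vertex `a` and reverses the coordinate
directions in which `a` has entry `1`. -/
noncomputable def cubeReflection (a : EuclideanSpace ℝ (Fin n)) (ha : IsCubeVertex a) :
    EuclideanSpace ℝ (Fin n) ≃ᵢ EuclideanSpace ℝ (Fin n) :=
  IsometryEquiv.mk' (fun x => WithLp.toLp 2 fun i => a i + (1 - 2 * a i) * x i)
    (fun x => WithLp.toLp 2 fun i => a i + (1 - 2 * a i) * x i)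
    (fun x => by
      ext i
      rcases ha i with h | h
      · simp [h]
      · simp only [h]
        ring)
    (Isometry.of_dist_eq fun x y => by
      rw [EuclideanSpace.dist_eq, EuclideanSpace.dist_eq]
      congr 1
      refine Finset.sum_congr rfl fun i _ => ?_
      rw [Real.dist_eq, Real.dist_eq, sq_abs, sq_abs]
      rcases ha i with h | h
      · simp [h]
      · simp only [h]
        ring)

theorem cubeReflection_apply {a : EuclideanSpace ℝ (Fin n)} (ha : IsCubeVertex a)
    (x : EuclideanSpace ℝ (Fin n)) (i : Fin n) :
    cubeReflection a ha x i = a i + (1 - 2 * a i) * x i := rfl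

theorem cubeReflection_cubeReflection {a : EuclideanSpace ℝ (Fin n)} (ha : IsCubeVertex a)
    (x : EuclideanSpace ℝ (Fin n)) : cubeReflection a ha (cubeReflection a ha x) = x :=
  (cubeReflection a ha).apply_symm_apply x

theorem cubeReflection_pathVertex {a : EuclideanSpace ℝ (Fin n)} (ha : IsCubeVertex a)
    (σ : Equiv.Perm (Fin n)) (k : Fin (n + 1)) (i : Fin n) :
    cubeReflection a ha (pathVertex σ k) i = if (σ.symm i : ℕ) < k then 1 - a i else a i := by
  rw [cubeReflection_apply, pathVertex_apply]
  split_ifs <;> ring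

theorem isCubeSymmetry_cubeReflection {a : EuclideanSpace ℝ (Fin n)} (ha : IsCubeVertex a) :
    IsCubeSymmetry (cubeReflection a ha) := by
  have h : ∀ x ∈ unitCube n, cubeReflection a ha x ∈ unitCube n := by
    intro x hx i
    have := hx i
    rw [cubeReflection_apply]
    rcases ha i with h | h <;> rw [h] <;> constructor <;> linarith
  refine Set.Subset.antisymm (Set.image_subset_iff.2 h) fun x hx => ?_
  exact ⟨_, h x hx, cubeReflection_cubeReflection ha x⟩

theorem IsCubeVertex.cubeReflection {a v : EuclideanSpace ℝ (Fin n)} (ha : IsCubeVertex a)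
    (hv : IsCubeVertex v) : IsCubeVertex (cubeReflection a ha v) := by
  intro i
  rw [cubeReflection_apply]
  rcases ha i with h | h <;> rcases hv i with h' | h' <;> norm_num [h, h']

theorem isNonobtuseBinaryTriangulation_reflection {a : EuclideanSpace ℝ (Fin n)}
    (ha : IsCubeVertex a) : IsNonobtuseBinaryTriangulation
      (mapTriangulation (cubeReflection a ha) (standardTriangulation n)) :=
  isNonobtuseBinaryTriangulation_standardTriangulation.map_isometryEquiv
    (isCubeSymmetry_cubeReflection ha) fun _ hv => ha.cubeReflection hv

theorem mem_reflection_of_path {S : Finset (EuclideanSpace ℝ (Fin n))}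
    {v : Fin (n + 1) → EuclideanSpace ℝ (Fin n)} (hS : IsBinarySimplex S)
    (hinj : Function.Injective v) (hrange : Set.range v = (S : Set (EuclideanSpace ℝ (Fin n))))
    (horth : ∀ i j : Fin n, i ≠ j →
      inner ℝ (v i.succ - v i.castSucc) (v j.succ - v j.castSucc) = 0)
    (h0 : IsCubeVertex (v 0)) :
    S ∈ mapTriangulation (cubeReflection (v 0) h0) (standardTriangulation n) := by
  have hv : ∀ k, IsCubeVertex (v k) := fun k =>
    hS.isCubeVertex _ (by rw [← Finset.mem_coe, ← hrange]; exact ⟨k, rfl⟩)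
  obtain ⟨σ, hσ⟩ := exists_perm_of_orthogonal_path hv hinj horth
  refine ⟨_, ⟨σ, rfl⟩, ?_⟩
  have hvσ : v = cubeReflection (v 0) h0 ∘ pathVertex σ := by
    funext k
    ext j
    rw [Function.comp_apply, cubeReflection_pathVertex, hσ]
  rw [← Finset.coe_inj, Finset.coe_map, ← range_pathVertex, ← Set.range_comp, ← hrange]
  exact congrArg Set.range hvσ.symm

theorem mem_of_mem_reflection {a w : EuclideanSpace ℝ (Fin n)} (ha : IsCubeVertex a)
    (hw : ∀ i, w i = 1 - a i) {S : Finset (EuclideanSpace ℝ (Fin n))}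
    (hS : S ∈ mapTriangulation (cubeReflection a ha) (standardTriangulation n)) :
    a ∈ S ∧ w ∈ S := by
  obtain ⟨_, ⟨σ, rfl⟩, rfl⟩ := hS
  have h : ∀ k, cubeReflection a ha (pathVertex σ k) ∈
      (standardSimplex σ).map (cubeReflection a ha).toEquiv.toEmbedding := fun k =>
    Finset.mem_map_of_mem _ (by rw [← Finset.mem_coe, ← range_pathVertex]; exact ⟨k, rfl⟩)
  constructor
  · convert h 0
    ext i
    rw [cubeReflection_pathVertex, if_neg (by simp)]
  · convert h (Fin.last n)
    ext i
    rw [cubeReflection_pathVertex, if_pos (by simp), hw]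

/-- A nonobtuse binary triangulation that contains a path simplex starting at `a` is the image of
the standard triangulation under the symmetry that moves the origin to `a`. -/
theorem IsNonobtuseBinaryTriangulation.eq_reflection
    {T : Set (Finset (EuclideanSpace ℝ (Fin n)))} (hT : IsNonobtuseBinaryTriangulation T)
    {a : EuclideanSpace ℝ (Fin n)} (ha : IsCubeVertex a)
    {S : Finset (EuclideanSpace ℝ (Fin n))} (hST : S ∈ T)
    (hS : S ∈ mapTriangulation (cubeReflection a ha) (standardTriangulation n)) :
    T = mapTriangulation (cubeReflection a ha) (standardTriangulation n) := by
  set w : EuclideanSpace ℝ (Fin n) := WithLp.toLp 2 fun i => 1 - a i with hw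
  have haw : ∀ i, w i = 1 - a i := fun _ => rfl
  refine hT.1.eq_of_edge (isNonobtuseBinaryTriangulation_reflection ha).1
    (fun S' hS' => mem_of_mem_reflection ha haw hS') ?_ hST
    (mem_of_mem_reflection ha haw hS).1 (mem_of_mem_reflection ha haw hS).2
  intro S' hS' haS' hwS'
  -- A simplex of `T` on the diagonal is a path starting at `a` itself, so the same reflection works
  -- for all of them.
  obtain ⟨v, rfl, hinj, hrange, horth⟩ :=
    exists_path_of_antipodal (hT.1.isBinarySimplex S' hS') (hT.2 S' hS') haS' hwS' haw
  exact mem_reflection_of_path (hT.1.isBinarySimplex S' hS') hinj hrange horth ha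

theorem IsPathSimplex.exists_mem_reflection {S : Finset (EuclideanSpace ℝ (Fin n))}
    (hS : IsPathSimplex S) : ∃ (a : EuclideanSpace ℝ (Fin n)) (ha : IsCubeVertex a),
      S ∈ mapTriangulation (cubeReflection a ha) (standardTriangulation n) := by
  obtain ⟨hbin, v, hinj, hrange, horth⟩ := hS
  have h0 : IsCubeVertex (v 0) :=
    hbin.isCubeVertex _ (by rw [← Finset.mem_coe, ← hrange]; exact ⟨0, rfl⟩)
  exact ⟨v 0, h0, mem_reflection_of_path hbin hinj hrange horth h0⟩

end Symmetry

end CubeTriangulation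

theorem mainTheorem5 (n : ℕ) (hn : 1 ≤ n) :
    -- the standard triangulation is a nonobtuse binary triangulation into `n!` path simplices
    CubeTriangulation.IsNonobtuseBinaryTriangulation
        (CubeTriangulation.standardTriangulation n) ∧
    (CubeTriangulation.standardTriangulation n).ncard = Nat.factorial n ∧
    (∀ S ∈ CubeTriangulation.standardTriangulation n, CubeTriangulation.IsPathSimplex S) ∧
    -- up to symmetries of the cube it is the only one that contains a path simplex
    (∀ T : Set (Finset (EuclideanSpace ℝ (Fin n))),
      CubeTriangulation.IsNonobtuseBinaryTriangulation T →
      (∃ S ∈ T, CubeTriangulation.IsPathSimplex S) →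
        ∃ g : EuclideanSpace ℝ (Fin n) ≃ᵢ EuclideanSpace ℝ (Fin n),
          CubeTriangulation.IsCubeSymmetry g ∧
            T = CubeTriangulation.mapTriangulation g
              (CubeTriangulation.standardTriangulation n)) ∧
    -- a given path simplex lies in exactly one nonobtuse binary triangulation
    (∀ S : Finset (EuclideanSpace ℝ (Fin n)), CubeTriangulation.IsPathSimplex S →
      ∃! T : Set (Finset (EuclideanSpace ℝ (Fin n))),
        CubeTriangulation.IsNonobtuseBinaryTriangulation T ∧ S ∈ T) ∧
    -- a nonobtuse binary simplex that contains a long diagonal of the cube is a path simplex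
    (∀ S : Finset (EuclideanSpace ℝ (Fin n)), CubeTriangulation.IsBinarySimplex S →
      CubeTriangulation.IsNonobtuse S →
      (∃ v ∈ S, ∃ w ∈ S, ∀ i, w i = 1 - v i) → CubeTriangulation.IsPathSimplex S) := by
  refine ⟨CubeTriangulation.isNonobtuseBinaryTriangulation_standardTriangulation,
    CubeTriangulation.ncard_standardTriangulation, ?_, ?_, ?_, ?_⟩
  · rintro _ ⟨σ, rfl⟩
    exact CubeTriangulation.isPathSimplex_standardSimplex σ
  · rintro T hT ⟨S, hST, hS⟩
    obtain ⟨a, ha, hSa⟩ := hS.exists_mem_reflection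
    exact ⟨_, CubeTriangulation.isCubeSymmetry_cubeReflection ha, hT.eq_reflection ha hST hSa⟩
  · intro S hS
    obtain ⟨a, ha, hSa⟩ := hS.exists_mem_reflection
    exact ⟨_, ⟨CubeTriangulation.isNonobtuseBinaryTriangulation_reflection ha, hSa⟩,
      fun T hT => hT.1.eq_reflection ha hT.2 hSa⟩
  · rintro S hS hno ⟨v, hv, w, hw, hvw⟩
    obtain ⟨p, -, hp⟩ := CubeTriangulation.exists_path_of_antipodal hS hno hv hw hvw
    exact ⟨hS, p, hp⟩
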